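/- Let $k\ge a\ge 1$ and $n\ge 0$ be integers. Let $\overline{W}_{k,a}(n)$ be the number of partitions $\lambda_1\ge\lambda_2\ge\cdots\ge\lambda_s>0$ of $n$ (for $n=0$ only the empty partition) such that $\lambda_j-\lambda_{j+k-1}\ge 2$ for all $j$ with $1\le j\le s-k+1$, at most $a-1$ of the $\lambda_j$ are equal to $1$, and every odd part appears an even number of times. Consider lattice paths in the first quadrant (all vertices have nonnegative coordinates) that start at a point of the $y$-axis, end on the $x$-axis, and use the steps $NE:(x,y)\to(x+1,y+1)$, $SE:(x,y)\to(x+1,y-1)$ and $E:(x,0)\to(x+1,0)$ (so East steps occur only at height $0$); a path is either empty (no steps) or ends with an $SE$ step. The height of a vertex is its $y$-coordinate and its weight is its $x$-coordinate. A peak is a vertex preceded by an $NE$ step and followed by an $SE$ step. The major index of a path is the sum of the weights of its peaks. A path satisfies the $(k,a)$-conditions if it starts at height $k-a$ and all its vertices have height less than $k$. Let $\overline{P}_{k,a}(n)$ be the number of lattice paths that satisfy the $(k,a)$-conditions, have major index $n$, and all of whose peaks have even weight. Then $\overline{P}_{k,a}(n)$ is finite and $$\overline{W}_{k,a}(n)=\overline{P}_{k,a}(n).$$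 -/

import Mathlib

/-- The parts of a partition listed in non-increasing order `λ₁ ≥ λ₂ ≥ ⋯ ≥ λₛ`
(the list is indexed from `0`). -/
def sortedParts {n : ℕ} (p : n.Partition) : List ℕ :=
  p.parts.sort (fun x y => y ≤ x)

/-- The Rogers–Ramanujan–Gordon condition: `λ_j - λ_{j+k-1} ≥ 2` whenever both parts exist,
and at most `a - 1` of the parts are equal to `1` (used for `k ≥ a ≥ 1`). -/
def IsGordonPartition (k a : ℕ) {n : ℕ} (p : n.Partition) : Prop :=
  (∀ (j : ℕ) (hj : j + (k - 1) < (sortedParts p).length),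
      (sortedParts p)[j + (k - 1)] + 2 ≤ (sortedParts p)[j]) ∧
    p.parts.count 1 ≤ a - 1

/-- Every odd part appears an even number of times. -/
def OddPartsAppearEvenly {n : ℕ} (p : n.Partition) : Prop :=
  ∀ i ∈ p.parts, Odd i → Even (p.parts.count i)

open Classical in
/-- The number of partitions of `n` that satisfy the Gordon condition for `(k, a)` and in which
every odd part appears an even number of times. -/
noncomputable def oddEvenGordonCount (k a n : ℕ) : ℕ :=
  (Finset.univ.filter
    (fun p : n.Partition => IsGordonPartition k a p ∧ OddPartsAppearEvenly p)).card

/-- The three unitary steps: North–East, South–East and East. -/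
inductive PathStep : Type
  | NE
  | SE
  | E
  deriving DecidableEq

/-- The change of height along a step; every step increases the abscissa by `1`. -/
def PathStep.rise : PathStep → ℤ
  | .NE => 1
  | .SE => -1
  | .E => 0

/-- The height of the vertex of abscissa `x` on the path that starts at `(0, start)`
and follows `steps`. -/
def pathHeight (start : ℕ) (steps : List PathStep) (x : ℕ) : ℤ :=
  (start : ℤ) + ((steps.take x).map PathStep.rise).sum

/-- Lattice paths in the first quadrant that start on the `y`-axis, end on the `x`-axis, use
North–East, South–East and East steps, the latter only at height `0`, and are either empty or
end with a South–East step. The vertices are `(x, pathHeight start steps x)` for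
`0 ≤ x ≤ steps.length`. -/
@[ext]
structure LatticePath : Type where
  start : ℕ
  steps : List PathStep
  height_nonneg : ∀ x ≤ steps.length, 0 ≤ pathHeight start steps x
  east_at_zero : ∀ x, steps[x]? = some PathStep.E → pathHeight start steps x = 0
  ends_on_axis : pathHeight start steps steps.length = 0
  empty_or_ends_SE : steps = [] ∨ steps.getLast? = some PathStep.SE

namespace LatticePath

/-- The height of the vertex of weight (abscissa) `x`. -/
def height (L : LatticePath) (x : ℕ) : ℤ :=
  pathHeight L.start L.steps x

/-- The weights (abscissas) of the peaks: the vertices preceded by a North–East step and followed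
by a South–East step. The step from `x` to `x + 1` is `steps[x]`. -/
def peakWeights (L : LatticePath) : Finset ℕ :=
  (Finset.range L.steps.length).filter
    (fun x => 1 ≤ x ∧ L.steps[x - 1]? = some PathStep.NE ∧ L.steps[x]? = some PathStep.SE)

/-- The major index: the sum of the weights of the peaks. -/
def majorIndex (L : LatticePath) : ℕ :=
  ∑ x ∈ L.peakWeights, x

/-- The (special) `(k, a)`-conditions: the path starts at height `k - a`, and its height is
always less than `k`. -/
def SatisfiesConditions (L : LatticePath) (k a : ℕ) : Prop :=
  L.start + a = k ∧ ∀ x ≤ L.steps.length, L.height x < (k : ℤ)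

end LatticePath

/-- The set of lattice paths of major index `n` that satisfy the `(k, a)`-conditions and all of
whose peaks have even weight. -/
def evenPeakPaths (k a n : ℕ) : Set LatticePath :=
  {L | L.SatisfiesConditions k a ∧ L.majorIndex = n ∧ ∀ x ∈ L.peakWeights, Even x}

/-!
The proof is Burge's correspondence between multiplicity sequences and lattice paths.

A partition satisfying the Gordon condition is encoded by the sequence `f` with `f 0 = k - a` and
with `f i` the multiplicity of `i` for `i ≥ 1`; the condition becomes `f i + f (i + 1) < k` for
all `i` (`gordon_iff_count`). Group the positions of `f`, starting from the largest part, into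
disjoint pairs `{i - 1, i}` with `f i > 0`, greedily from the right, and move one unit from `i` to
`i - 1` in every pair. This is a `BurgeMove`, recorded by the indicator `t` of the tops `i` of the
pairs. At the left end, `t 1 = 1` raises `f 0` by one, `t 0 = 1` lowers it by one (the unit leaves
the sequence), and otherwise `f 0 = 0` is unchanged. Reading these cases as the steps `NE`, `SE`
and `E` and iterating until `f` vanishes gives a path of initial height `f 0`. A move can be undone
once the step is known, because the pairs can be recovered greedily from the left; this inverse is
`undoStep`, and iterating it gives the map `multiplicities` from step lists to sequences, which is
a bijection (`multiplicities_injective`, `exists_isGoodPath`).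

One move lowers the weight `∑ i * f i` by the number of tops `i ≥ 1`. That number changes between
successive moves exactly when the path passes a peak (`BurgeMove.sum_tops_succ`), so it counts the
peaks still ahead, and the total weight is the major index (`sum_multiplicities`).

For the parity refinement, consider two successive moves `f → f' → f''`, that is, two steps of the
path. The odd-indexed multiplicities of `f` are all even if and only if those of `f''` are and the
two steps do not form a peak (`BurgeMove.evenAtOdd_iff`). Hence the multiplicities of the odd parts
are even exactly when no peak has odd weight.
-/

/-! ### Moves on multiplicity sequences -/

/-- `f'` is obtained from `f` by moving one unit from `i` to `i - 1` for every `i` with `t i = 1`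
(the unit leaves the sequence if `i = 0`). The pairs `{i - 1, i}` with `t i = 1` are disjoint and
cover the support of `f`. The definition is symmetric enough to determine `t` both from `f`
(from the right) and from `f'` and `t 0` (from the left). -/
structure BurgeMove (f f' t : ℕ → ℕ) : Prop where
  disjoint : ∀ i, t i + t (i + 1) ≤ 1
  cover : ∀ i, t i + t (i + 1) = 0 → f i = 0
  move : ∀ i, f i + t (i + 1) = f' i + t i

/-- The multiplicities of the odd numbers are even. -/
def EvenAtOdd (f : ℕ → ℕ) : Prop :=
  ∀ i, Odd i → Even (f i)

namespace BurgeMove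

variable {f f' f'' t t' : ℕ → ℕ}

theorem eq_one_iff_left (m : BurgeMove f f' t) (i : ℕ) :
    t i = 1 ↔ 0 < f i ∧ t (i + 1) = 0 := by
  have h1 := m.disjoint i
  have h2 := m.cover i
  have h3 := m.move i
  omega

theorem eq_one_iff_right (m : BurgeMove f f' t) (i : ℕ) :
    t (i + 1) = 1 ↔ 0 < f' i ∧ t i = 0 := by
  have h1 := m.disjoint i
  have h2 := m.cover i
  have h3 := m.move i
  omega

theorem tops_eq_zero (m : BurgeMove f f' t) {N : ℕ} (hf : ∀ i, N ≤ i → f i = 0) :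
    ∀ i, N ≤ i → t i = 0 := by
  intro i hi
  have h1 := m.disjoint i
  have h2 := m.eq_one_iff_left i
  have h3 := hf i hi
  omega

/-- The tops are determined by `f`, reading from beyond the support of `f` downwards. -/
theorem tops_unique {f₁ f₂ t₁ t₂ : ℕ → ℕ} (m₁ : BurgeMove f f₁ t₁) (m₂ : BurgeMove f f₂ t₂)
    {N : ℕ} (hf : ∀ i, N ≤ i → f i = 0) : t₁ = t₂ := by
  have key : ∀ d i, N ≤ i + d → t₁ i = t₂ i := by
    intro d
    induction d with
    | zero =>
      intro i hi
      rw [m₁.tops_eq_zero hf i hi, m₂.tops_eq_zero hf i hi]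
    | succ d ih =>
      intro i hi
      have h := ih (i + 1) (by omega)
      have h1 := m₁.disjoint i
      have h2 := m₁.eq_one_iff_left i
      have h3 := m₂.disjoint i
      have h4 := m₂.eq_one_iff_left i
      omega
  funext i
  exact key N i (by omega)

theorem target_unique {f₁ f₂ : ℕ → ℕ} (m₁ : BurgeMove f f₁ t) (m₂ : BurgeMove f f₂ t) :
    f₁ = f₂ := by
  funext i
  have h1 := m₁.move i
  have h2 := m₂.move i
  omega

theorem source_unique {f₁ f₂ : ℕ → ℕ} (m₁ : BurgeMove f₁ f' t) (m₂ : BurgeMove f₂ f' t) :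
    f₁ = f₂ := by
  funext i
  have h1 := m₁.move i
  have h2 := m₂.move i
  omega

theorem tops_unique_right {f₁ f₂ t₁ t₂ : ℕ → ℕ} (m₁ : BurgeMove f₁ f' t₁)
    (m₂ : BurgeMove f₂ f' t₂) (h0 : t₁ 0 = t₂ 0) : t₁ = t₂ := by
  funext i
  induction i with
  | zero => exact h0
  | succ i ih =>
    have h1 := m₁.disjoint i
    have h2 := m₁.eq_one_iff_right i
    have h3 := m₂.disjoint i
    have h4 := m₂.eq_one_iff_right i
    omega

theorem source_eq_zero_of_target (m : BurgeMove f f' t) (h0 : t 0 = 0) (hf' : f' = 0) :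
    f = 0 := by
  have ht : ∀ i, t i = 0 := by
    intro i
    induction i with
    | zero => exact h0
    | succ i ih =>
      have h1 := m.disjoint i
      have h2 := m.eq_one_iff_right i
      have h3 : f' i = 0 := by rw [hf']; rfl
      omega
  funext i
  exact m.cover i (by rw [ht, ht])

theorem add_lt_of_source (m : BurgeMove f f' t) {k : ℕ} (hf : ∀ i, f i + f (i + 1) < k) (i : ℕ) :
    f' i + f' (i + 1) < k := by
  have h := hf i
  have h1 := m.disjoint i
  have h2 := m.cover i
  have h3 := m.move i
  have h4 := m.disjoint (i + 1)
  have h5 := m.cover (i + 1)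
  have h6 := m.move (i + 1)
  have h7 := hf (i + 1)
  have h8 := m.eq_one_iff_left (i + 1 + 1)
  have h9 := m.disjoint (i + 1 + 1)
  omega

/-- The bound on adjacent sums is inherited backwards as well; at the left end, where a unit may
have left the sequence, the bound on `f 0` has to be supplied. -/
theorem add_lt_of_target (m : BurgeMove f f' t) {k : ℕ} (h0 : f 0 < k)
    (hf' : ∀ i, f' i + f' (i + 1) < k) (i : ℕ) : f i + f (i + 1) < k := by
  have h := hf' i
  have h1 := m.disjoint i
  have h2 := m.cover i
  have h3 := m.move i
  have h4 := m.disjoint (i + 1)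
  have h5 := m.cover (i + 1)
  have h6 := m.move (i + 1)
  cases i with
  | zero => omega
  | succ j =>
    have g := hf' j
    have g1 := m.disjoint j
    have g3 := m.move j
    omega

theorem weight_eq (m : BurgeMove f f' t) (N : ℕ) :
    ∑ i ∈ Finset.range N, i * f i + N * t N =
      ∑ i ∈ Finset.range N, i * f' i + ∑ i ∈ Finset.range N, t (i + 1) := by
  induction N with
  | zero => simp
  | succ N ih =>
    rw [Finset.sum_range_succ, Finset.sum_range_succ _ N, Finset.sum_range_succ _ N]
    have h : N * f N + N * t (N + 1) = N * f' N + N * t N := by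
      rw [← mul_add, ← mul_add, m.move N]
    rw [add_mul]
    omega

/-- The number of tops `i ≥ 1` drops by one from a move to the next if the first has top `1` and
the second has top `0`, and is unchanged otherwise: every pair of the first move contains exactly
one top of the second, and positions outside all pairs contain none. The last summand on the left
accounts for a pair cut by the end of the range. -/
theorem sum_tops_succ (m : BurgeMove f f' t) (m' : BurgeMove f' f'' t') (N : ℕ) :
    ∑ i ∈ Finset.range N, t (i + 1) + t (N + 1) * t' N =
      ∑ i ∈ Finset.range N, t' (i + 1) + t 1 * t' 0 := by
  induction N with
  | zero => simp
  | succ N ih =>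
    rw [Finset.sum_range_succ, Finset.sum_range_succ _ N]
    have h1 := m.disjoint (N + 1)
    have h2 := m.cover (N + 1)
    have h3 := m.move (N + 1)
    have h4 := m.eq_one_iff_right N
    have h5 := m'.disjoint N
    have h6 := m'.cover N
    have h7 := m'.eq_one_iff_left (N + 1)
    have h8 := m'.disjoint (N + 1)
    rcases (by omega : t (N + 1) = 0 ∨ t (N + 1) = 1) with h | h
    · rw [h, zero_mul] at ih
      rcases (by omega : t (N + 1 + 1) = 0 ∨ t (N + 1 + 1) = 1) with g | g
      · rw [g, zero_mul]
        omega
      · rw [g, one_mul]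
        omega
    · rw [h, one_mul] at ih
      have g : t (N + 1 + 1) = 0 := by omega
      rw [g, zero_mul]
      omega

/-- If an odd top of the first move always stays a top in the second, then the two moves together
change the odd-indexed multiplicities by even amounts. -/
theorem even_iff_of_odd_tops (m : BurgeMove f f' t) (m' : BurgeMove f' f'' t')
    (h : ∀ j, Odd j → t j = 1 → t' j = 1) {i : ℕ} (hi : Odd i) : Even (f i) ↔ Even (f'' i) := by
  have h1 := m.disjoint i
  have h2 := m.cover i
  have h3 := m.move i
  have h4 := m.move (i + 1)
  have h5 := m.cover (i + 1)
  have h6 := m.disjoint (i + 1)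
  have g1 := m'.disjoint i
  have g2 := m'.cover i
  have g3 := m'.move i
  have g4 := m'.disjoint (i + 1)
  have g5 := m'.eq_one_iff_left (i + 1)
  have e1 := h i hi
  have e2 := h (i + 1 + 1) (by simpa [parity_simps] using hi)
  rw [Nat.even_iff, Nat.even_iff]
  omega

/-- If the odd-indexed multiplicities of the source are even, then every odd top stays a top in
the next move. -/
theorem odd_tops_of_source (m : BurgeMove f f' t) (m' : BurgeMove f' f'' t') {N : ℕ}
    (hN : ∀ i, N ≤ i → f i = 0) (hf : EvenAtOdd f) (j : ℕ) (hj : Odd j) (ht : t j = 1) :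
    t' j = 1 := by
  -- A failure at `j` propagates to `j + 2`, `j + 4`, …, beyond the support of `f`.
  have key : ∀ d j, N ≤ j + d → Odd j → t j = 1 → t' j = 1 := by
    intro d
    induction d with
    | zero =>
      intro j hj _ ht
      have := m.tops_eq_zero hN j hj
      omega
    | succ d ih =>
      intro j hj ho ht
      have e := ih (j + 1 + 1) (by omega) (by simpa [parity_simps] using ho)
      have p := hf j ho
      rw [Nat.even_iff] at p
      have h1 := m.disjoint j
      have h2 := m.cover j
      have h3 := m.move j
      have h4 := m.disjoint (j + 1)
      have h5 := m.cover (j + 1)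
      have h6 := m.move (j + 1)
      have g1 := m'.disjoint j
      have g2 := m'.cover j
      have g3 := m'.eq_one_iff_left (j + 1)
      have g4 := m'.disjoint (j + 1)
      omega
  exact key N j (by omega) hj ht

/-- If the odd-indexed multiplicities after two moves are even and the two moves do not form a
peak, then every odd top of the first move is a top of the second. -/
theorem odd_tops_of_target (m : BurgeMove f f' t) (m' : BurgeMove f' f'' t')
    (hf : EvenAtOdd f'') (h0 : ¬(t 1 = 1 ∧ t' 0 = 1)) (j : ℕ) (hj : Odd j) (ht : t j = 1) :
    t' j = 1 := by
  -- A failure at `j` propagates to `j - 2`, `j - 4`, …, `1`, where it would be a peak.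
  obtain ⟨r, rfl⟩ := hj
  induction r with
  | zero =>
    have h1 := m.eq_one_iff_right 0
    have h2 := m'.disjoint 0
    have h3 := m'.cover 0
    simp only [mul_zero, zero_add] at *
    omega
  | succ r ih =>
    have p := hf (2 * r + 1) ⟨r, rfl⟩
    rw [Nat.even_iff] at p
    rw [show 2 * (r + 1) + 1 = 2 * r + 1 + 1 + 1 by ring] at ht ⊢
    have h1 := m.eq_one_iff_right (2 * r + 1 + 1)
    have h3 := m.move (2 * r + 1)
    have h4 := m.disjoint (2 * r + 1)
    have h5 := m.cover (2 * r + 1)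
    have h6 := m.disjoint (2 * r + 1 + 1)
    have g1 := m'.disjoint (2 * r + 1)
    have g2 := m'.disjoint (2 * r + 1 + 1)
    have g3 := m'.cover (2 * r + 1 + 1)
    have g4 := m'.move (2 * r + 1)
    omega

/-- The parity condition is invariant under two moves that do not form a peak. For two steps that
form one, the peak sits between them, at odd weight if the first step starts at even weight. -/
theorem evenAtOdd_iff (m : BurgeMove f f' t) (m' : BurgeMove f' f'' t') {N : ℕ}
    (hN : ∀ i, N ≤ i → f i = 0) :
    EvenAtOdd f ↔ EvenAtOdd f'' ∧ ¬(t 1 = 1 ∧ t' 0 = 1) := by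
  constructor
  · intro hf
    have h := m.odd_tops_of_source m' hN hf
    refine ⟨fun i hi => (m.even_iff_of_odd_tops m' h hi).1 (hf i hi), fun ⟨h1, h2⟩ => ?_⟩
    have h3 := h 1 odd_one h1
    have h4 := m'.disjoint 0
    simp only [zero_add] at h4
    omega
  · rintro ⟨hf, h0⟩ i hi
    exact (m.even_iff_of_odd_tops m' (m.odd_tops_of_target m' hf h0) hi).2 (hf i hi)

end BurgeMove

theorem exists_burgeMove {N : ℕ} {f : ℕ → ℕ} (hf : ∀ i, N ≤ i → f i = 0) :
    ∃ f' t, BurgeMove f f' t := by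
  have tops : ∃ t : ℕ → ℕ, ∀ i, t i + t (i + 1) ≤ 1 ∧ (t i + t (i + 1) = 0 → f i = 0) ∧
      t i ≤ f i := by
    induction N generalizing f with
    | zero => exact ⟨0, fun i => by simp [hf i (Nat.zero_le i)]⟩
    | succ N ih =>
      obtain ⟨t, ht⟩ := ih (f := fun i => f (i + 1)) (fun i hi => hf (i + 1) (by omega))
      refine ⟨fun i => match i with
        | 0 => if 0 < f 0 ∧ t 0 = 0 then 1 else 0
        | i + 1 => t i, fun i => ?_⟩
      cases i with
      | zero =>
        have h := ht 0
        dsimp only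
        split_ifs with h' <;> simp only [zero_add] at h <;> omega
      | succ i => exact ht i
  obtain ⟨t, ht⟩ := tops
  refine ⟨fun i => f i + t (i + 1) - t i, t, fun i => (ht i).1, fun i => (ht i).2.1, fun i => ?_⟩
  have := (ht i).2.2
  omega

/-! ### From step lists to multiplicity sequences -/

/-- The tops of the move that leads to `f'` by the step `s`: the step decides whether `0` is a
top, and every further top is forced. -/
def undoTops (s : PathStep) (f' : ℕ → ℕ) : ℕ → ℕ
  | 0 => if s = PathStep.SE then 1 else 0
  | i + 1 => if 0 < f' i ∧ undoTops s f' i = 0 then 1 else 0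

/-- The sequence from which the step `s` leads to `f'`. -/
def undoStep (s : PathStep) (f' : ℕ → ℕ) (i : ℕ) : ℕ :=
  f' i + undoTops s f' i - undoTops s f' (i + 1)

theorem undoTops_zero (s : PathStep) (f : ℕ → ℕ) : undoTops s f 0 = 1 ↔ s = PathStep.SE := by
  simp [undoTops]

theorem burgeMove_undoStep (s : PathStep) (f' : ℕ → ℕ) :
    BurgeMove (undoStep s f') f' (undoTops s f') := by
  have h1 : ∀ i, undoTops s f' i ≤ 1 := by
    intro i
    cases i <;> (unfold undoTops; split_ifs <;> omega)
  have h2 : ∀ i, undoTops s f' (i + 1) = if 0 < f' i ∧ undoTops s f' i = 0 then 1 else 0 :=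
    fun i => rfl
  refine ⟨fun i => ?_, fun i h => ?_, fun i => ?_⟩ <;> have a := h1 i <;> have b := h2 i
  · split_ifs at b <;> omega
  · rw [undoStep]
    split_ifs at b <;> omega
  · rw [undoStep]
    split_ifs at b <;> omega

/-- The multiplicity sequence encoded by a list of steps. -/
def multiplicities : List PathStep → ℕ → ℕ
  | [] => 0
  | s :: l => undoStep s (multiplicities l)

theorem burgeMove_cons (s : PathStep) (l : List PathStep) :
    BurgeMove (multiplicities (s :: l)) (multiplicities l) (undoTops s (multiplicities l)) :=
  burgeMove_undoStep s _

theorem multiplicities_eq_zero_of_le (l : List PathStep) :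
    ∀ i, l.length ≤ i → multiplicities l i = 0 := by
  induction l with
  | nil => exact fun _ _ => rfl
  | cons s l ih =>
    intro i hi
    rw [List.length_cons] at hi
    have m := burgeMove_cons s l
    obtain ⟨j, rfl⟩ : ∃ j, i = j + 1 := ⟨i - 1, by omega⟩
    have h1 := ih j (by omega)
    have h2 := ih (j + 1) (by omega)
    have h3 := m.eq_one_iff_right j
    have h4 := m.disjoint j
    have h5 := m.disjoint (j + 1)
    have h6 := m.move (j + 1)
    omega

/-- The paths with given initial height and heights less than `k`, in recursive form. Excluding a
final `E` step amounts to ending with an `SE` step, since `NE` cannot lead to the axis. -/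
inductive IsGoodPath (k : ℕ) : ℕ → List PathStep → Prop
  | nil : 0 < k → IsGoodPath k 0 []
  | ne {h : ℕ} {l : List PathStep} : IsGoodPath k (h + 1) l → IsGoodPath k h (PathStep.NE :: l)
  | se {h : ℕ} {l : List PathStep} :
      h + 1 < k → IsGoodPath k h l → IsGoodPath k (h + 1) (PathStep.SE :: l)
  | e {l : List PathStep} : l ≠ [] → IsGoodPath k 0 l → IsGoodPath k 0 (PathStep.E :: l)

namespace IsGoodPath

variable {k h : ℕ} {s : PathStep} {l : List PathStep}

theorem lt (p : IsGoodPath k h l) : h < k := by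
  induction p with
  | nil hk => exact hk
  | ne _ ih => omega
  | se hk _ _ => exact hk
  | e _ _ ih => exact ih

theorem tail (p : IsGoodPath k h (s :: l)) : ∃ h', IsGoodPath k h' l := by
  cases p with
  | ne q => exact ⟨_, q⟩
  | se _ q => exact ⟨_, q⟩
  | e _ q => exact ⟨_, q⟩

theorem multiplicities_zero (p : IsGoodPath k h l) : multiplicities l 0 = h := by
  induction p with
  | nil _ => rfl
  | @ne h l _ ih =>
    show multiplicities l 0 + undoTops PathStep.NE _ 0 - undoTops PathStep.NE _ 1 = h
    simp [undoTops, ih]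
  | @se h l _ _ ih =>
    show multiplicities l 0 + undoTops PathStep.SE _ 0 - undoTops PathStep.SE _ 1 = h + 1
    simp [undoTops, ih]
  | @e l _ _ ih =>
    show multiplicities l 0 + undoTops PathStep.E _ 0 - undoTops PathStep.E _ 1 = 0
    simp [undoTops, ih]

/-- Along a path, `NE` is exactly the step whose move has top `1`: after `NE` the height is
positive, and before `E` it is zero. -/
theorem undoTops_one (p : IsGoodPath k h (s :: l)) :
    undoTops s (multiplicities l) 1 = 1 ↔ s = PathStep.NE := by
  cases p with
  | ne q => simp [undoTops, q.multiplicities_zero]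
  | se _ q => simp [undoTops]
  | e _ q => simp [undoTops, q.multiplicities_zero]

theorem multiplicities_ne_zero (p : IsGoodPath k h l) (hl : l ≠ []) : multiplicities l ≠ 0 := by
  induction l generalizing h with
  | nil => exact absurd rfl hl
  | cons s l ih =>
    intro h0
    have m := burgeMove_cons s l
    have ht : ∀ i, undoTops s (multiplicities l) i = 0 := fun i =>
      m.tops_eq_zero (N := 0) (fun j _ => congrFun h0 j) i (Nat.zero_le i)
    have n0 := undoTops_zero s (multiplicities l)
    have n1 := p.undoTops_one
    rw [ht] at n0 n1
    cases p with
    | ne q => simp at n1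
    | se _ q => simp at n0
    | e hne q =>
      refine ih q hne (funext fun i => ?_)
      have h1 := m.move i
      rw [ht, ht, h0] at h1
      exact h1.symm

end IsGoodPath

theorem multiplicities_injective {k h h' : ℕ} {l l' : List PathStep} (p : IsGoodPath k h l)
    (p' : IsGoodPath k h' l') (heq : multiplicities l = multiplicities l') : l = l' := by
  induction l generalizing h h' l' with
  | nil =>
    by_contra hne
    exact p'.multiplicities_ne_zero (Ne.symm hne) heq.symm
  | cons s l ih =>
    cases l' with
    | nil => exact absurd heq (p.multiplicities_ne_zero (List.cons_ne_nil _ _))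
    | cons s' l' =>
      have m := burgeMove_cons s l
      have m' := burgeMove_cons s' l'
      rw [← heq] at m'
      have ht := m.tops_unique m' (multiplicities_eq_zero_of_le _)
      rw [← ht] at m'
      obtain ⟨_, q⟩ := p.tail
      obtain ⟨_, q'⟩ := p'.tail
      have hl := ih q q' (m.target_unique m')
      have h0 := undoTops_zero s (multiplicities l)
      have h0' := undoTops_zero s' (multiplicities l')
      have h1 := p.undoTops_one
      have h1' := p'.undoTops_one
      rw [ht] at h0 h1
      have e0 := h0.symm.trans h0'
      have e1 := h1.symm.trans h1'
      rw [hl]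
      cases s <;> cases s' <;> simp_all

/-- Every finitely supported sequence with adjacent sums less than `k` comes from a path. The
induction is on `∑ (i + 1) * f i`, which every move of a nonzero sequence lowers. -/
theorem exists_isGoodPath {k N : ℕ} {f : ℕ → ℕ} (hN : ∀ i, N ≤ i → f i = 0)
    (hf : ∀ i, f i + f (i + 1) < k) : ∃ l, IsGoodPath k (f 0) l ∧ multiplicities l = f := by
  induction hM : ∑ i ∈ Finset.range N, (i + 1) * f i using Nat.strong_induction_on
    generalizing f with
  | _ M ih =>
  by_cases h0 : f = 0
  · subst h0
    exact ⟨[], .nil ((Nat.zero_le _).trans_lt (hf 0)), rfl⟩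
  obtain ⟨f', t, m⟩ := exists_burgeMove hN
  have htN := m.tops_eq_zero hN
  have hN' : ∀ i, N ≤ i → f' i = 0 := by
    intro i hi
    have h1 := m.move i
    have h2 := hN i hi
    have h3 := htN i hi
    have h4 := htN (i + 1) (by omega)
    omega
  have hsum : ∑ i ∈ Finset.range N, (i + 1) * f i =
      ∑ i ∈ Finset.range N, (i + 1) * f' i + ∑ i ∈ Finset.range N, t i := by
    have key : ∀ n, ∑ i ∈ Finset.range n, (i + 1) * f i + n * t n =
        ∑ i ∈ Finset.range n, (i + 1) * f' i + ∑ i ∈ Finset.range n, t i := by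
      intro n
      induction n with
      | zero => simp
      | succ n ihn =>
        rw [Finset.sum_range_succ, Finset.sum_range_succ _ n, Finset.sum_range_succ _ n]
        have h : (n + 1) * f n + (n + 1) * t (n + 1) = (n + 1) * f' n + (n * t n + t n) := by
          rw [← mul_add, m.move n]
          ring
        omega
    have h := key N
    rwa [htN N le_rfl, mul_zero, add_zero] at h
  have hpos : 0 < ∑ i ∈ Finset.range N, t i := by
    by_contra hz
    have hz' : ∀ i, t i = 0 := by
      intro i
      rcases lt_or_ge i N with hi | hi
      · exact (Finset.sum_eq_zero_iff.1 (by omega)) i (Finset.mem_range.2 hi)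
      · exact htN i hi
    exact h0 (funext fun i => m.cover i (by rw [hz', hz']))
  obtain ⟨l, hl, rfl⟩ := ih _ (by omega) hN' (m.add_lt_of_source hf) rfl
  have build : ∀ s, (t 0 = 1 ↔ s = PathStep.SE) → multiplicities (s :: l) = f := by
    intro s hs
    have m' := burgeMove_cons s l
    have ht : undoTops s (multiplicities l) = t := by
      refine m'.tops_unique_right m ?_
      have h1 := undoTops_zero s (multiplicities l)
      have h2 := m.disjoint 0
      have h3 := m'.disjoint 0
      rw [← hs] at h1
      omega
    rw [ht] at m'
    exact m'.source_unique m
  have d0 := m.disjoint 0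
  have v0 := m.move 0
  simp only [zero_add] at d0 v0
  rcases (by omega : t 0 = 1 ∨ t 0 = 0) with e0 | e0
  · refine ⟨PathStep.SE :: l, ?_, build _ (by simp [e0])⟩
    have e : f 0 = multiplicities l 0 + 1 := by omega
    have hk := hf 0
    rw [e] at hk ⊢
    exact .se (by omega) hl
  · rcases (by omega : t 1 = 1 ∨ t 1 = 0) with e1 | e1
    · refine ⟨PathStep.NE :: l, ?_, build _ (by simp [e0])⟩
      have e : multiplicities l 0 = f 0 + 1 := by omega
      rw [e] at hl
      exact .ne hl
    · refine ⟨PathStep.E :: l, ?_, build _ (by simp [e0])⟩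
      have e : f 0 = 0 := m.cover 0 (by simp [e0, e1])
      have e' : multiplicities l 0 = 0 := by omega
      rw [e'] at hl
      rw [e]
      refine .e (fun hnil => h0 (m.source_eq_zero_of_target e0 ?_)) hl
      rw [hnil]
      rfl

theorem IsGoodPath.multiplicities_add_lt {k h : ℕ} {l : List PathStep} (p : IsGoodPath k h l) :
    ∀ i, multiplicities l i + multiplicities l (i + 1) < k := by
  induction l generalizing h with
  | nil => exact fun i => (Nat.zero_le _).trans_lt p.lt
  | cons s l ih =>
    obtain ⟨_, q⟩ := p.tail
    exact (burgeMove_cons s l).add_lt_of_target (p.multiplicities_zero.trans_lt p.lt) (ih q)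

/-! ### Peaks and the major index -/

/-- The abscissas of the peaks of a list of steps. -/
def peaks (l : List PathStep) : Finset ℕ :=
  (Finset.range l.length).filter
    (fun x => 1 ≤ x ∧ l[x - 1]? = some PathStep.NE ∧ l[x]? = some PathStep.SE)

theorem succ_mem_peaks {l : List PathStep} {x : ℕ} :
    x + 1 ∈ peaks l ↔ l[x]? = some PathStep.NE ∧ l[x + 1]? = some PathStep.SE := by
  simp only [peaks, Finset.mem_filter, Finset.mem_range, Nat.add_sub_cancel]
  constructor
  · rintro ⟨_, _, h⟩
    exact h
  · intro h
    exact ⟨(List.getElem?_eq_some_iff.1 h.2).1, by omega, h⟩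

theorem zero_notMem_peaks (l : List PathStep) : 0 ∉ peaks l := by
  simp [peaks]

theorem one_mem_peaks_cons_cons {s s' : PathStep} {l : List PathStep} :
    1 ∈ peaks (s :: s' :: l) ↔ s = PathStep.NE ∧ s' = PathStep.SE := by
  rw [← zero_add 1, succ_mem_peaks]
  simp

theorem add_two_mem_peaks_cons {s : PathStep} {l : List PathStep} {x : ℕ} :
    x + 2 ∈ peaks (s :: l) ↔ x + 1 ∈ peaks l := by
  rw [succ_mem_peaks, succ_mem_peaks]
  simp

theorem peaks_cons (s : PathStep) (l : List PathStep) :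
    peaks (s :: l) = (peaks l).image (· + 1) ∪ if 1 ∈ peaks (s :: l) then {1} else ∅ := by
  ext x
  rw [Finset.mem_union, Finset.mem_image]
  match x with
  | 0 => split_ifs <;> simp [zero_notMem_peaks]
  | 1 => split_ifs <;> simp_all [zero_notMem_peaks]
  | x + 2 =>
    rw [add_two_mem_peaks_cons]
    split_ifs <;> simp

theorem disjoint_peaks_cons (s : PathStep) (l : List PathStep) :
    Disjoint ((peaks l).image (· + 1)) (if 1 ∈ peaks (s :: l) then {1} else ∅) := by
  split_ifs <;> simp [zero_notMem_peaks]

theorem card_peaks_cons (s : PathStep) (l : List PathStep) :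
    (peaks (s :: l)).card = (peaks l).card + if 1 ∈ peaks (s :: l) then 1 else 0 := by
  rw [peaks_cons, Finset.card_union_of_disjoint (disjoint_peaks_cons s l),
    Finset.card_image_of_injective _ (add_left_injective 1), ← peaks_cons]
  split_ifs <;> simp

theorem sum_peaks_cons (s : PathStep) (l : List PathStep) :
    ∑ x ∈ peaks (s :: l), x = ∑ x ∈ peaks l, x + (peaks (s :: l)).card := by
  rw [card_peaks_cons]
  nth_rewrite 1 [peaks_cons]
  rw [Finset.sum_union (disjoint_peaks_cons s l),
    Finset.sum_image (add_left_injective 1).injOn, Finset.sum_add_distrib]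
  split_ifs <;> simp [add_assoc]

/-- The number of tops `i ≥ 1` of the first move is the number of peaks of the path. -/
theorem sum_undoTops {k h : ℕ} {s : PathStep} {l : List PathStep} (p : IsGoodPath k h (s :: l))
    {N : ℕ} (hN : l.length ≤ N) :
    ∑ i ∈ Finset.range N, undoTops s (multiplicities l) (i + 1) = (peaks (s :: l)).card := by
  induction l generalizing h s with
  | nil =>
    have h1 : peaks [s] = ∅ := by
      ext x
      simp only [peaks, List.length_singleton, Finset.range_one, Finset.mem_filter,
        Finset.mem_singleton, Finset.notMem_empty, iff_false]
      omega
    rw [h1, Finset.card_empty]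
    exact Finset.sum_eq_zero fun i _ => by simp [undoTops, multiplicities]
  | cons s' l ih =>
    rw [List.length_cons] at hN
    obtain ⟨_, q⟩ := p.tail
    have h1 := (burgeMove_cons s (s' :: l)).sum_tops_succ (burgeMove_cons s' l) N
    have h2 := (burgeMove_cons s (s' :: l)).tops_eq_zero (multiplicities_eq_zero_of_le _) (N + 1)
      (by simp only [List.length_cons]; omega)
    have h3 := p.undoTops_one
    have h4 := undoTops_zero s' (multiplicities l)
    have h5 := (burgeMove_cons s (s' :: l)).disjoint 0
    have h6 := (burgeMove_cons s' l).disjoint 0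
    rw [h2, zero_mul, add_zero, ih q (by omega)] at h1
    have hpk := one_mem_peaks_cons_cons (s := s) (s' := s') (l := l)
    rw [← h3, ← h4] at hpk
    rw [h1, card_peaks_cons s (s' :: l)]
    split_ifs with hp
    · rw [(hpk.1 hp).1, (hpk.1 hp).2]
    · rw [hpk] at hp
      rw [Nat.add_left_cancel_iff, Nat.mul_eq_zero]
      simp only [zero_add] at h5
      omega

theorem sum_multiplicities {k h : ℕ} {l : List PathStep} (p : IsGoodPath k h l)
    {N : ℕ} (hN : l.length ≤ N) :
    ∑ i ∈ Finset.range N, i * multiplicities l i = ∑ x ∈ peaks l, x := by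
  induction l generalizing h with
  | nil => simp [multiplicities, peaks]
  | cons s l ih =>
    obtain ⟨_, q⟩ := p.tail
    have m := burgeMove_cons s l
    have h1 := m.weight_eq N
    have h2 := m.tops_eq_zero (multiplicities_eq_zero_of_le _) N hN
    rw [List.length_cons] at hN
    rw [h2, mul_zero, add_zero, ih q (by omega), sum_undoTops p (by omega)] at h1
    rw [h1, sum_peaks_cons]

theorem evenAtOdd_multiplicities_iff {k h : ℕ} {l : List PathStep} (p : IsGoodPath k h l) :
    EvenAtOdd (multiplicities l) ↔ ∀ x ∈ peaks l, Even x := by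
  induction hn : l.length using Nat.strong_induction_on generalizing h l with
  | _ n ih =>
  match l, p, hn with
  | [], _, _ => exact iff_of_true (fun i _ => ⟨0, rfl⟩) (by simp [peaks])
  | [s], _, _ =>
    refine iff_of_true (fun i hi => ?_) (by simp [peaks])
    rw [multiplicities_eq_zero_of_le [s] i hi.pos]
    exact ⟨0, rfl⟩
  | s :: s' :: l, p, hn =>
    obtain ⟨_, q⟩ := p.tail
    obtain ⟨_, r⟩ := q.tail
    simp only [List.length_cons] at hn
    rw [(burgeMove_cons s (s' :: l)).evenAtOdd_iff (burgeMove_cons s' l)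
      (multiplicities_eq_zero_of_le _), ih _ (by omega) r rfl, p.undoTops_one,
      undoTops_zero, ← one_mem_peaks_cons_cons (l := l)]
    constructor
    · rintro ⟨h1, h2⟩ x hx
      match x with
      | 0 => exact Even.zero
      | 1 => exact absurd hx h2
      | 2 => exact even_two
      | x + 3 =>
        rw [add_two_mem_peaks_cons (x := x + 1), add_two_mem_peaks_cons (x := x)] at hx
        have := h1 _ hx
        simpa [parity_simps] using this
    · intro hx
      refine ⟨fun x hx' => ?_, fun h1 => Nat.not_even_one (hx 1 h1)⟩
      match x with
      | 0 => exact Even.zero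
      | x + 1 =>
        have := hx (x + 3)
          (add_two_mem_peaks_cons (x := x + 1) |>.2 (add_two_mem_peaks_cons (x := x) |>.2 hx'))
        simpa [parity_simps] using this

/-! ### Lattice paths as step lists -/

/-- The conditions on a lattice path of initial height `h` and heights less than `k`, in terms of
its heights. -/
def IsBoundedPath (k h : ℕ) (l : List PathStep) : Prop :=
  (∀ x ≤ l.length, 0 ≤ pathHeight h l x) ∧
    (∀ x, l[x]? = some PathStep.E → pathHeight h l x = 0) ∧
    pathHeight h l l.length = 0 ∧ (l = [] ∨ l.getLast? = some PathStep.SE) ∧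
    ∀ x ≤ l.length, pathHeight h l x < k

theorem pathHeight_zero (h : ℕ) (l : List PathStep) : pathHeight h l 0 = h := by
  simp [pathHeight]

theorem pathHeight_cons {h h' : ℕ} {s : PathStep} (hs : (h' : ℤ) = h + s.rise)
    (l : List PathStep) (x : ℕ) : pathHeight h (s :: l) (x + 1) = pathHeight h' l x := by
  simp only [pathHeight, List.take_succ_cons, List.map_cons, List.sum_cons, hs]
  ring

theorem isBoundedPath_cons {k h h' : ℕ} {s : PathStep} (hs : (h' : ℤ) = h + s.rise)
    (l : List PathStep) :
    IsBoundedPath k h (s :: l) ↔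
      h < k ∧ (s = PathStep.E → h = 0) ∧ (l = [] → s = PathStep.SE) ∧ IsBoundedPath k h' l := by
  have hlast : (s :: l = [] ∨ (s :: l).getLast? = some PathStep.SE) ↔
      (l = [] → s = PathStep.SE) ∧ (l = [] ∨ l.getLast? = some PathStep.SE) := by
    cases l <;> simp [List.getLast?_cons_cons]
  rw [IsBoundedPath, IsBoundedPath, hlast, List.length_cons, pathHeight_cons hs]
  constructor
  · rintro ⟨h1, h2, h3, ⟨h4, h5⟩, h6⟩
    refine ⟨?_, fun h => ?_, h4, fun x hx => ?_, fun x hx => ?_, h3, h5, fun x hx => ?_⟩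
    · simpa [pathHeight_zero] using h6 0 (Nat.zero_le _)
    · simpa [pathHeight_zero] using h2 0 (by simp [h])
    · rw [← pathHeight_cons hs]
      exact h1 _ (by omega)
    · rw [← pathHeight_cons hs]
      exact h2 _ (by simpa using hx)
    · rw [← pathHeight_cons hs]
      exact h6 _ (by omega)
  · rintro ⟨h1, h2, h3, h4, h5, h6, h7, h8⟩
    refine ⟨fun x hx => ?_, fun x hx => ?_, h6, ⟨h3, h7⟩, fun x hx => ?_⟩ <;>
      cases x <;> simp only [pathHeight_zero, pathHeight_cons hs]
    · omega
    · exact h4 _ (by omega)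
    · exact_mod_cast h2 (by simpa using hx)
    · exact h5 _ (by simpa using hx)
    · exact_mod_cast h1
    · exact h8 _ (by omega)

theorem isGoodPath_iff {k h : ℕ} {l : List PathStep} :
    IsGoodPath k h l ↔ IsBoundedPath k h l := by
  constructor
  · intro p
    induction p with
    | nil hk =>
      have : ∀ x, pathHeight 0 [] x = 0 := fun x => by simp [pathHeight]
      refine ⟨fun x _ => (this x).ge, fun x _ => this x, this _, Or.inl rfl, fun x _ => ?_⟩
      rw [this]
      exact_mod_cast hk
    | @ne h l q ih =>
      refine (isBoundedPath_cons (h' := h + 1) (by simp [PathStep.rise]) l).2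
        ⟨by have := q.lt; omega, by simp, fun hl => ?_, ih⟩
      subst hl
      nomatch q
    | @se h l hk q ih =>
      exact (isBoundedPath_cons (h' := h) (by simp [PathStep.rise]) l).2
        ⟨hk, by simp, fun _ => rfl, ih⟩
    | @e l hl q ih =>
      exact (isBoundedPath_cons (h' := 0) (by simp [PathStep.rise]) l).2
        ⟨q.lt, fun _ => rfl, fun h => absurd h hl, ih⟩
  · induction l generalizing h with
    | nil =>
      rintro ⟨_, _, h3, _, h5⟩
      have h6 := h5 0 (Nat.zero_le _)
      rw [List.length_nil, pathHeight_zero] at h3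
      rw [pathHeight_zero] at h6
      obtain rfl : h = 0 := by exact_mod_cast h3
      exact .nil (by exact_mod_cast h6)
    | cons s l ih =>
      intro p
      cases s with
      | NE => exact .ne (ih ((isBoundedPath_cons (by simp [PathStep.rise]) l).1 p).2.2.2)
      | SE =>
        have h0 := p.1 1 (by simp)
        simp only [pathHeight, List.take_succ_cons, List.take_zero, List.map_cons, List.map_nil,
          List.sum_cons, List.sum_nil, PathStep.rise] at h0
        obtain ⟨j, rfl⟩ : ∃ j, h = j + 1 := ⟨h - 1, by omega⟩
        have p' := (isBoundedPath_cons (h' := j) (by simp [PathStep.rise]) l).1 p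
        exact .se p'.1 (ih p'.2.2.2)
      | E =>
        have p' := (isBoundedPath_cons (h' := h) (by simp [PathStep.rise]) l).1 p
        obtain rfl := p'.2.1 rfl
        exact .e (fun hl => nomatch p'.2.2.1 hl) (ih p'.2.2.2)

/-- The finitely supported sequences `f` of weight `n` with `f 0 = h`, adjacent sums less than `k`
and even values at odd indices. -/
def evenSequences (k h n : ℕ) : Set (ℕ → ℕ) :=
  {f | f 0 = h ∧ (∀ i, f i + f (i + 1) < k) ∧ EvenAtOdd f ∧
    ∃ N, (∀ i, N ≤ i → f i = 0) ∧ ∀ M, N ≤ M → ∑ i ∈ Finset.range M, i * f i = n}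

theorem bijOn_multiplicities {k a : ℕ} (n : ℕ) (hak : a ≤ k) :
    Set.BijOn (fun L : LatticePath => multiplicities L.steps) (evenPeakPaths k a n)
      (evenSequences k (k - a) n) := by
  have good : ∀ L ∈ evenPeakPaths k a n, IsGoodPath k L.start L.steps := fun L hL =>
    isGoodPath_iff.2
      ⟨L.height_nonneg, L.east_at_zero, L.ends_on_axis, L.empty_or_ends_SE, hL.1.2⟩
  have start : ∀ L ∈ evenPeakPaths k a n, L.start = k - a := fun L hL => by
    have := hL.1.1
    omega
  refine ⟨fun L hL => ?_, fun L hL L' hL' heq => ?_, fun f hf => ?_⟩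
  · have p := good L hL
    exact ⟨p.multiplicities_zero.trans (start L hL), p.multiplicities_add_lt,
      (evenAtOdd_multiplicities_iff p).2 hL.2.2, L.steps.length,
      multiplicities_eq_zero_of_le _, fun M hM => (sum_multiplicities p hM).trans hL.2.1⟩
  · exact LatticePath.ext ((start L hL).trans (start L' hL').symm)
      (multiplicities_injective (good L hL) (good L' hL') heq)
  · obtain ⟨h0, hk, he, N, hN, hn⟩ := hf
    obtain ⟨l, p, rfl⟩ := exists_isGoodPath hN hk
    obtain ⟨h1, h2, h3, h4, h5⟩ := isGoodPath_iff.1 p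
    refine ⟨⟨_, l, h1, h2, h3, h4⟩, ⟨⟨?_, h5⟩, ?_, (evenAtOdd_multiplicities_iff p).1 he⟩, rfl⟩
    · show multiplicities l 0 + a = k
      omega
    · exact (sum_multiplicities p (le_max_left l.length N)).symm.trans (hn _ (le_max_right _ _))

/-! ### Partitions as multiplicity sequences -/

theorem List.count_add_count_succ (l : List ℕ) (i : ℕ) :
    l.count i + l.count (i + 1) = (l.filter fun x => x = i ∨ x = i + 1).length := by
  induction l with
  | nil => rfl
  | cons x l ih =>
    rw [List.count_cons, List.count_cons, List.filter_cons]
    simp only [beq_iff_eq, decide_eq_true_eq]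
    split_ifs <;> first | omega | (rw [List.length_cons]; omega)

/-- The first entry and the one at distance `m` in a sublist are at distance at least `m` in the
list. -/
theorem List.Sublist.exists_getElem_window {l' l : List ℕ} (hs : l'.Sublist l) {m : ℕ}
    (hm : m < l'.length) : ∃ (j r : ℕ) (hr : r < l.length) (hj : j + m ≤ r),
      l[j] ∈ l' ∧ l[r] ∈ l' := by
  obtain ⟨g, hg⟩ := List.sublist_iff_exists_fin_orderEmbedding_get_eq.1 hs
  have key : ∀ d (hd : d < l'.length), (g ⟨0, by omega⟩ : ℕ) + d ≤ g ⟨d, hd⟩ := by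
    intro d
    induction d with
    | zero => exact fun _ => le_rfl
    | succ d ih =>
      intro hd
      have h1 := ih (by omega)
      have h2 : (g ⟨d, by omega⟩ : ℕ) < g ⟨d + 1, hd⟩ :=
        g.strictMono (Fin.mk_lt_mk.2 d.lt_succ_self)
      omega
  refine ⟨g ⟨0, by omega⟩, g ⟨m, hm⟩, (g ⟨m, hm⟩).2, key m hm, ?_, ?_⟩
  · have := hg ⟨0, by omega⟩
    simp only [List.get_eq_getElem] at this
    rw [← this]
    exact List.getElem_mem _
  · have := hg ⟨m, hm⟩
    simp only [List.get_eq_getElem] at this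
    rw [← this]
    exact List.getElem_mem _

/-- In a non-increasing list, entries at distance `k - 1` differ by at least `2` if and only if no
`k` entries are contained in a set `{i, i + 1}`. -/
theorem gordon_iff_count {k : ℕ} (hk : 1 ≤ k) {l : List ℕ} (hl : l.Pairwise (fun x y => y ≤ x)) :
    (∀ (j : ℕ) (hj : j + (k - 1) < l.length), l[j + (k - 1)] + 2 ≤ l[j]) ↔
      ∀ i, l.count i + l.count (i + 1) < k := by
  have anti : ∀ (i j : ℕ) (hj : j < l.length) (hij : i ≤ j), l[j] ≤ l[i] := by
    intro i j hj hij
    rcases hij.lt_or_eq with h | rfl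
    · exact List.pairwise_iff_getElem.1 hl i j (by omega) hj h
    · exact le_rfl
  constructor
  · intro H i
    rw [List.count_add_count_succ]
    by_contra hlt
    obtain ⟨j, r, hr, hj, hj', hr'⟩ :=
      (List.filter_sublist (p := fun x => decide (x = i ∨ x = i + 1))
        (l := l)).exists_getElem_window (m := k - 1) (by omega)
    have h1 := H j (by omega)
    have h2 := anti (j + (k - 1)) r hr hj
    have h3 := (List.mem_filter.1 hj').2
    have h4 := (List.mem_filter.1 hr').2
    simp only [decide_eq_true_eq] at h3 h4
    omega
  · intro H j hj
    by_contra hlt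
    have hsub : ((l.drop j).take k).Sublist l :=
      (List.take_sublist _ _).trans (List.drop_sublist _ _)
    have hfil : ((l.drop j).take k).filter
        (fun x => x = l[j + (k - 1)] ∨ x = l[j + (k - 1)] + 1) = (l.drop j).take k := by
      rw [List.filter_eq_self]
      intro x hx
      obtain ⟨r, hr, rfl⟩ := List.mem_iff_getElem.1 hx
      rw [List.length_take, List.length_drop] at hr
      rw [List.getElem_take, List.getElem_drop]
      have h1 := anti j (j + r) (by omega) (by omega)
      have h2 := anti (j + r) (j + (k - 1)) hj (by omega)
      simp only [decide_eq_true_eq]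
      omega
    have h1 := H l[j + (k - 1)]
    have h2 := List.count_add_count_succ ((l.drop j).take k) l[j + (k - 1)]
    rw [hfil, List.length_take, List.length_drop] at h2
    have h3 := hsub.count_le l[j + (k - 1)]
    have h4 := hsub.count_le (l[j + (k - 1)] + 1)
    omega

/-- The multiplicities of the parts of `p`, preceded by the value `h` at index `0`. -/
def partitionSequence (h : ℕ) {n : ℕ} (p : n.Partition) (i : ℕ) : ℕ :=
  if i = 0 then h else p.parts.count i

theorem isGordonPartition_iff {k a n : ℕ} (ha : 1 ≤ a) (hak : a ≤ k) (p : n.Partition) :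
    IsGordonPartition k a p ↔
      ∀ i, partitionSequence (k - a) p i + partitionSequence (k - a) p (i + 1) < k := by
  have hc : ∀ i, (sortedParts p).count i = p.parts.count i := fun i => by
    rw [sortedParts, ← Multiset.coe_count, Multiset.sort_eq]
  have h0 : p.parts.count 0 = 0 :=
    Multiset.count_eq_zero.2 fun h => (p.parts_pos h).ne' rfl
  have hs : (sortedParts p).Pairwise (fun x y => y ≤ x) := Multiset.pairwise_sort _ _
  rw [IsGordonPartition, gordon_iff_count (ha.trans hak) hs]
  simp only [hc, partitionSequence, Nat.add_one_ne_zero, if_false]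
  constructor
  · rintro ⟨h1, h2⟩ i
    split_ifs with hi
    · subst hi
      rw [zero_add]
      omega
    · exact h1 i
  · intro H
    have h1 := H 0
    rw [if_pos rfl, zero_add] at h1
    refine ⟨fun i => ?_, by omega⟩
    rcases Nat.eq_zero_or_pos i with rfl | hi
    · simp only [h0, zero_add]
      omega
    · simpa [hi.ne'] using H i

theorem oddPartsAppearEvenly_iff {n : ℕ} (h : ℕ) (p : n.Partition) :
    OddPartsAppearEvenly p ↔ EvenAtOdd (partitionSequence h p) := by
  constructor
  · intro H i hi
    rw [partitionSequence, if_neg hi.pos.ne']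
    by_cases hm : i ∈ p.parts
    · exact H i hm hi
    · rw [Multiset.count_eq_zero.2 hm]
      exact Even.zero
  · intro H i _ hi
    have := H i hi
    rwa [partitionSequence, if_neg hi.pos.ne'] at this

theorem bijOn_partitionSequence {k a : ℕ} (n : ℕ) (ha : 1 ≤ a) (hak : a ≤ k) :
    Set.BijOn (partitionSequence (k - a))
      {p : n.Partition | IsGordonPartition k a p ∧ OddPartsAppearEvenly p}
      (evenSequences k (k - a) n) := by
  refine ⟨fun p hp => ?_, fun p _ q _ heq => ?_, fun f hf => ?_⟩
  · have hle : ∀ i ∈ p.parts, i ≤ n := fun i hi =>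
      (Multiset.le_sum_of_mem hi).trans p.parts_sum.le
    refine ⟨if_pos rfl, (isGordonPartition_iff ha hak p).1 hp.1,
      (oddPartsAppearEvenly_iff _ p).1 hp.2, n + 1, fun i hi => ?_, fun M hM => ?_⟩
    · rw [partitionSequence, if_neg (by omega), Multiset.count_eq_zero]
      intro h
      have := hle i h
      omega
    · refine Eq.trans ?_ p.parts_sum
      rw [Finset.sum_multiset_count_of_subset p.parts (Finset.range M)]
      · refine Finset.sum_congr rfl fun i _ => ?_
        rw [partitionSequence, smul_eq_mul]
        split_ifs with hi
        · simp [hi]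
        · exact mul_comm _ _
      · intro i hi
        have := hle i (Multiset.mem_toFinset.1 hi)
        rw [Finset.mem_range]
        omega
  · refine Nat.Partition.ext (Multiset.ext.2 fun i => ?_)
    have h := congrFun heq i
    rw [partitionSequence, partitionSequence] at h
    split_ifs at h with hi
    · rw [hi, Multiset.count_eq_zero.2 fun h => (p.parts_pos h).ne' rfl,
        Multiset.count_eq_zero.2 fun h => (q.parts_pos h).ne' rfl]
    · exact h
  · obtain ⟨h0, hk, he, N, hN, hn⟩ := hf
    have hsum : (∑ i ∈ Finset.range N, Multiset.replicate (f i) i).sum = n := by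
      rw [← hn N le_rfl, Multiset.sum_sum]
      exact Finset.sum_congr rfl fun i _ => by rw [Multiset.sum_replicate, smul_eq_mul, mul_comm]
    have hp : partitionSequence (k - a) (Nat.Partition.ofSums n _ hsum) = f := by
      funext i
      rw [partitionSequence]
      split_ifs with hi
      · rw [hi, h0]
      · rw [Nat.Partition.count_ofSums_of_ne_zero _ hi, Multiset.count_sum']
        simp only [Multiset.count_replicate]
        rw [Finset.sum_ite_eq']
        split_ifs with hr
        · rfl
        · exact (hN i (by simpa using hr)).symm
    refine ⟨_, ⟨(isGordonPartition_iff ha hak _).2 ?_, (oddPartsAppearEvenly_iff (k - a) _).2 ?_⟩,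
      hp⟩ <;> rw [hp]
    exacts [hk, he]

theorem mainTheorem2 (k a n : ℕ) (ha : 1 ≤ a) (hak : a ≤ k) :
    (evenPeakPaths k a n).Finite ∧
      oddEvenGordonCount k a n = (evenPeakPaths k a n).ncard := by
  have b₁ := bijOn_partitionSequence n ha hak
  have b₂ := bijOn_multiplicities n hak
  refine ⟨b₂.finite_iff_finite.2 (b₁.finite_iff_finite.1 (Set.toFinite _)), ?_⟩
  rw [b₂.ncard_eq, ← b₁.ncard_eq, oddEvenGordonCount, ← Set.ncard_coe_finset]
  simp
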